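/- For $x\in(0,1]$ let $[1/x]$ be the integer part of $1/x$, and put $a_1(x)=[1/x]+1$ and $\mathscr L(x)=[1/x]\,([1/x]+1)\,x-[1/x]\in(0,1]$. The Lüroth digits of $x$ are the integers $a_n(x)=a_1(\mathscr L^{\,n-1}(x))\ge 2$, $n\ge 1$; they are the unique sequence of integers $a_n\ge 2$ with $$x=\frac1{a_1}+\frac1{a_1(a_1-1)a_2}+\cdots+\frac1{a_1(a_1-1)\cdots a_{n-1}(a_{n-1}-1)a_n}+\cdots .$$ Let $Q_1(x)=a_1(x)$ and $Q_{n+1}(x)=Q_n(x)\,(a_n(x)-1)\,a_{n+1}(x)$ for $n\ge 1$. **Theorem.** For every real $\beta>0$, $$\frac{2}{3+\beta+\sqrt{\beta^2+6\beta+1}}\;\le\;\dim_H\left\{x\in(0,1]:\ \lim_{n\to\infty}\frac{\log a_{n+1}(x)}{\log Q_n(x)}=\beta\right\}\;\le\;\frac1{2+\beta},$$ where $\dim_H$ denotes Hausdorff dimension. -/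

import Mathlib

open Set Filter Topology MeasureTheory

noncomputable section

namespace Luroth

/-- The Lüroth map `L x = [1/x]([1/x] + 1) x - [1/x]`. It maps `(0, 1]` into itself, and `L 0 = 0`
because `1 / 0 = 0` in Lean. -/
def lurothMap (x : ℝ) : ℝ :=
  (⌊1 / x⌋ : ℝ) * ((⌊1 / x⌋ : ℝ) + 1) * x - (⌊1 / x⌋ : ℝ)

/-- The first Lüroth digit `a₁(x) = [1/x] + 1` of `x ∈ (0, 1]`. (The value at points outside `(0, 1]`
is irrelevant, since the Lüroth map preserves `(0, 1]`.) -/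
def firstDigit (x : ℝ) : ℕ := ⌊1 / x⌋₊ + 1

/-- The Lüroth digits, counted from zero: `digit x k` is the digit `a_{k+1}(x) = a₁(L^k x)`, so that
`x = 1/a₁ + 1/(a₁(a₁-1)a₂) + 1/(a₁(a₁-1)a₂(a₂-1)a₃) + ⋯` for `x ∈ (0, 1]`. -/
def digit (x : ℝ) (k : ℕ) : ℕ := firstDigit (lurothMap^[k] x)

/-- The Lüroth continuants, counted from zero: `continuant x k` is `Q_{k+1}(x)`, where `Q₁ = a₁` and
`Q_{n+1} = Q_n (a_n - 1) a_{n+1}`. All digits are at least `1`, so the subtraction is exact. -/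
def continuant (x : ℝ) : ℕ → ℕ
  | 0 => digit x 0
  | k + 1 => continuant x k * (digit x k - 1) * digit x (k + 1)

/-- The set of all `x ∈ (0, 1]` with `log a_{n+1}(x) / log Q_n(x) → β` as `n → ∞`. With `n = k + 1`,
the digit `a_{n+1}` is `digit x (k + 1)` and `Q_n` is `continuant x k`. -/
def growthSet (β : ℝ) : Set ℝ :=
  {x | x ∈ Ioc (0 : ℝ) 1 ∧
    Tendsto (fun k : ℕ => Real.log (digit x (k + 1)) / Real.log (continuant x k)) atTop (𝓝 β)}

end Luroth

end

/-!
# Hausdorff dimension of a set of Lüroth expansions with fast growing digits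

On a cylinder of order `n` the `n`-th iterate of the Lüroth map is affine with slope
`∏ a_i (a_i - 1)`, and `Q_n` is this slope for `n - 1` times `a_n`. So distances within a cylinder
are read off from distances between iterates (`iterate_sub_iterate`).

*Upper bound.* Let `0 < γ < β`. A point of the set satisfies `a_{n+1} ≥ Q_n ^ γ` from some index on.
Within a cylinder of order `n`, the points with this property lie in an interval of length at most
`4 Q_n ^ (-(1 + γ)) a_n⁻¹`. Passing to the children `a` of the cylinder multiplies this length by at
most a constant times `a ^ (-(2 + γ))`. For `s > 1 / (2 + γ)` the sum of the `s`-th powers of these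
factors over `a ≥ Q_n ^ γ` is a tail of a convergent series, so it is at most `1` once `n` is large,
and the `s`-dimensional Hausdorff measure of a cylinder of the set is finite
(`hausdorffMeasure_codeCylinder_le`, `exists_dimH_fastSet_le`).

*Lower bound.* Let `l` be the positive root of `l ^ 2 = (1 + β) l + β`; the bound is `1 / (1 + l)`.
With `A_n = ⌈exp (l ^ n)⌉` every point all of whose digits satisfy `A_n ≤ a_n < 2 A_n` belongs to the
set (`mem_growthSet`). The unit interval parametrizes these points: expand `t` in a Cantor series
with digits `c_n < A_n` and take the point with Lüroth digits `A_n + c_n`. If `t` and `u` first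
differ at the `n`-th digit, by `j`, and `P = A_0 ⋯ A_n`, then `|t - u|` is at most of order `j / P`,
while the distance between their images is at least of order `j / (C ^ n P ^ 2)` (`separation`). For
`r < 1 / (1 + l)` the inverse of the parametrization is therefore `r`-Hölder continuous
(`holder_of_separation`, `exists_bound_geometric_mul_exp`), and since it maps onto `[0, 1)`, the
dimension is at least `r`.
-/

namespace Luroth

/-! ### Digits and branches of the Lüroth map -/

theorem floor_one_div_eq {x : ℝ} (hx : x ∈ Ioc (0 : ℝ) 1) :
    (⌊1 / x⌋ : ℝ) = (firstDigit x : ℝ) - 1 := by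
  have h0 : (0 : ℝ) ≤ 1 / x := one_div_nonneg.mpr hx.1.le
  rw [← natCast_floor_eq_intCast_floor h0]
  simp [firstDigit]

theorem two_le_firstDigit {x : ℝ} (hx : x ∈ Ioc (0 : ℝ) 1) : 2 ≤ firstDigit x := by
  have h : 1 ≤ ⌊1 / x⌋₊ := Nat.le_floor (by simpa using one_le_one_div hx.1 hx.2)
  unfold firstDigit
  omega

theorem lurothMap_eq {x : ℝ} (hx : x ∈ Ioc (0 : ℝ) 1) :
    lurothMap x = ((firstDigit x : ℝ) * (firstDigit x - 1)) * x - (firstDigit x - 1) := by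
  rw [lurothMap, floor_one_div_eq hx]
  ring

theorem one_lt_firstDigit_mul {x : ℝ} (hx : x ∈ Ioc (0 : ℝ) 1) : 1 < firstDigit x * x := by
  have h := Int.lt_floor_add_one (1 / x)
  rw [floor_one_div_eq hx, sub_add_cancel, div_lt_iff₀ hx.1] at h
  exact h

theorem firstDigit_sub_one_mul_le {x : ℝ} (hx : x ∈ Ioc (0 : ℝ) 1) :
    ((firstDigit x : ℝ) - 1) * x ≤ 1 := by
  have h := Int.floor_le (1 / x)
  rwa [floor_one_div_eq hx, le_div_iff₀ hx.1] at h

theorem lurothMap_mem {x : ℝ} (hx : x ∈ Ioc (0 : ℝ) 1) : lurothMap x ∈ Ioc (0 : ℝ) 1 := by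
  have h1 := one_lt_firstDigit_mul hx
  have h2 := firstDigit_sub_one_mul_le hx
  have h3 : (2 : ℝ) ≤ firstDigit x := by exact_mod_cast two_le_firstDigit hx
  rw [lurothMap_eq hx]
  constructor <;> nlinarith

theorem iterate_lurothMap_mem {x : ℝ} (hx : x ∈ Ioc (0 : ℝ) 1) (k : ℕ) :
    lurothMap^[k] x ∈ Ioc (0 : ℝ) 1 := by
  induction k with
  | zero => simpa using hx
  | succ k ih => rw [Function.iterate_succ_apply']; exact lurothMap_mem ih

theorem two_le_digit {x : ℝ} (hx : x ∈ Ioc (0 : ℝ) 1) (k : ℕ) : (2 : ℝ) ≤ digit x k := by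
  exact_mod_cast two_le_firstDigit (iterate_lurothMap_mem hx k)

theorem iterate_lurothMap_succ {x : ℝ} (hx : x ∈ Ioc (0 : ℝ) 1) (k : ℕ) :
    lurothMap^[k + 1] x =
      ((digit x k : ℝ) * (digit x k - 1)) * lurothMap^[k] x - (digit x k - 1) := by
  rw [Function.iterate_succ_apply', lurothMap_eq (iterate_lurothMap_mem hx k)]
  rfl

/-- The product `∏_{i < k} a_i (a_i - 1)` over the first `k` digits of `x`, that is, the slope of
the `k`-th iterate of the Lüroth map on the cylinder of order `k` around `x`. -/
noncomputable def slope (x : ℝ) (k : ℕ) : ℝ :=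
  ∏ i ∈ Finset.range k, ((digit x i : ℝ) * (digit x i - 1))

theorem slope_pos {x : ℝ} (hx : x ∈ Ioc (0 : ℝ) 1) (k : ℕ) : 0 < slope x k := by
  refine Finset.prod_pos fun i _ => ?_
  have := two_le_digit hx i
  exact mul_pos (by linarith) (by linarith)

theorem continuant_eq {x : ℝ} (hx : x ∈ Ioc (0 : ℝ) 1) (k : ℕ) :
    (continuant x k : ℝ) = slope x k * digit x k := by
  induction k with
  | zero => simp [continuant, slope]
  | succ k ih =>
    have h : 1 ≤ digit x k := by
      have := two_le_digit hx k
      exact_mod_cast (by linarith : (1 : ℝ) ≤ digit x k)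
    rw [continuant, slope, Finset.prod_range_succ, ← slope]
    push_cast [h]
    rw [ih]
    ring

/-- On a common cylinder of order `k` the `k`-th iterate of the Lüroth map is affine. -/
theorem iterate_sub_iterate {x y : ℝ} (hx : x ∈ Ioc (0 : ℝ) 1) (hy : y ∈ Ioc (0 : ℝ) 1) (k : ℕ)
    (h : ∀ i < k, digit x i = digit y i) :
    lurothMap^[k] x - lurothMap^[k] y = slope x k * (x - y) := by
  induction k with
  | zero => simp [slope]
  | succ k ih =>
    have ih' := ih fun i hi => h i (by omega)
    rw [iterate_lurothMap_succ hx, iterate_lurothMap_succ hy, ← h k (by omega), slope,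
      Finset.prod_range_succ, ← slope]
    linear_combination ((digit x k : ℝ) * (digit x k - 1)) * ih'

theorem continuant_congr {x y : ℝ} (k : ℕ) (h : ∀ i ≤ k, digit x i = digit y i) :
    continuant x k = continuant y k := by
  induction k with
  | zero => exact h 0 le_rfl
  | succ k ih =>
    rw [continuant, continuant, ih fun i hi => h i (by omega), h k (by omega), h (k + 1) le_rfl]

theorem two_pow_le_continuant {x : ℝ} (hx : x ∈ Ioc (0 : ℝ) 1) (k : ℕ) :
    2 ^ (k + 1) ≤ continuant x k := by
  have hd : ∀ i, 2 ≤ digit x i := fun i => by exact_mod_cast two_le_digit hx i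
  induction k with
  | zero => simpa [continuant] using hd 0
  | succ k ih =>
    have h1 : 1 ≤ digit x k - 1 := by have := hd k; omega
    calc 2 ^ (k + 1 + 1) = 2 ^ (k + 1) * 1 * 2 := by ring
      _ ≤ continuant x k * (digit x k - 1) * digit x (k + 1) :=
        Nat.mul_le_mul (Nat.mul_le_mul ih h1) (hd _)

/-! ### A covering criterion for Hausdorff measure -/

/-- The points of `E` whose first `k + 1` symbols, read by the coding `d`, are those of `x`. -/
def codeCylinder {X : Type*} (E : Set X) (d : X → ℕ → ℕ) (k : ℕ) (x : X) : Set X :=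
  {y ∈ E | ∀ i ≤ k, d y i = d x i}

open scoped ENNReal in
/-- If the weights `J` bound the `s`-th powers of the diameters of the cylinders of `E`, and the
total weight of the children of a cylinder is at most the weight of the cylinder, then the
`s`-dimensional Hausdorff measure of each cylinder is at most its weight. Each of the outer measures
whose supremum is the Hausdorff measure is countably subadditive, so the bound passes from the
children to the parent; at a depth where all diameters are small it holds by definition. -/
theorem hausdorffMeasure_codeCylinder_le {X : Type*} [EMetricSpace X] [MeasurableSpace X]
    [BorelSpace X] {E : Set X} {d : X → ℕ → ℕ} {s : ℝ} {N : ℕ} {J : ℕ → X → ℝ≥0∞}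
    {w : ℕ → X → ℕ → ℝ≥0∞} {δ : ℕ → ℝ≥0∞} (hδ : Tendsto δ atTop (𝓝 0))
    (hdiam : ∀ k ≥ N, ∀ x ∈ E, Metric.ediam (codeCylinder E d k x) ≤ δ k)
    (hJ : ∀ k ≥ N, ∀ x ∈ E, Metric.ediam (codeCylinder E d k x) ^ s ≤ J k x)
    (hstep : ∀ k ≥ N, ∀ x ∈ E, ∀ y ∈ codeCylinder E d k x,
      J (k + 1) y ≤ J k x * w k x (d y (k + 1)))
    (hw : ∀ k ≥ N, ∀ x ∈ E, ∑' a, w k x a ≤ 1) {x : X} (hx : x ∈ E) {k : ℕ} (hk : N ≤ k) :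
    μH[s] (codeCylinder E d k x) ≤ J k x := by
  set c : Set X → ℝ≥0∞ := fun t => Metric.ediam t ^ s with hc
  have key : ∀ r : ℝ≥0∞, ∀ m k : ℕ, N ≤ k → (∀ j ≥ k + m, δ j ≤ r) → ∀ x ∈ E,
      OuterMeasure.mkMetric'.pre c r (codeCylinder E d k x) ≤ J k x := by
    intro r m
    induction m with
    | zero =>
      intro k hk hr x hx
      exact (OuterMeasure.mkMetric'.pre_le ((hdiam k hk x hx).trans (hr k (by simp)))).trans
        (hJ k hk x hx)
    | succ m ih =>
      intro k hk hr x hx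
      have hsub : codeCylinder E d k x ⊆
          ⋃ a, {y ∈ codeCylinder E d k x | d y (k + 1) = a} := fun y hy =>
        mem_iUnion.2 ⟨d y (k + 1), hy, rfl⟩
      have hchild : ∀ a, OuterMeasure.mkMetric'.pre c r
          {y ∈ codeCylinder E d k x | d y (k + 1) = a} ≤ J k x * w k x a := by
        intro a
        rcases Set.eq_empty_or_nonempty {y ∈ codeCylinder E d k x | d y (k + 1) = a} with h | h
        · rw [h]; simp
        · obtain ⟨y, hy, rfl⟩ := h
          refine le_trans (measure_mono ?_) ((ih (k + 1) (by omega)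
            (fun j hj => hr j (by omega)) y hy.1).trans (hstep k hk x hx y hy))
          rintro z ⟨hz, hz'⟩
          refine ⟨hz.1, fun i hi => ?_⟩
          rcases Nat.lt_or_ge k i with h | h
          · obtain rfl : i = k + 1 := by omega
            exact hz'
          · rw [hz.2 i h, hy.2 i h]
      calc OuterMeasure.mkMetric'.pre c r (codeCylinder E d k x)
          ≤ ∑' a, OuterMeasure.mkMetric'.pre c r
            {y ∈ codeCylinder E d k x | d y (k + 1) = a} :=
            (measure_mono hsub).trans (measure_iUnion_le _)
        _ ≤ ∑' a, J k x * w k x a := ENNReal.tsum_le_tsum hchild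
        _ = J k x * ∑' a, w k x a := ENNReal.tsum_mul_left
        _ ≤ J k x * 1 := by gcongr; exact hw k hk x hx
        _ = J k x := mul_one _
  have hH : μH[s] (codeCylinder E d k x) =
      OuterMeasure.mkMetric' c (codeCylinder E d k x) := by
    rw [Measure.hausdorffMeasure, ← OuterMeasure.coe_mkMetric]
    rfl
  rw [hH, OuterMeasure.mkMetric']
  simp only [OuterMeasure.iSup_apply]
  refine iSup₂_le fun r hr => ?_
  obtain ⟨m, hm⟩ := eventually_atTop.1 (hδ.eventually_le_const hr)
  exact key r m k hk (fun j hj => hm j (by omega)) x hx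

/-! ### The upper bound -/

/-- The points of `(0, 1]` whose digits satisfy `a_{n+1} ≥ Q_n ^ β` from the index `N` on, the index
being that of `continuant`. -/
def fastSet (β : ℝ) (N : ℕ) : Set ℝ :=
  {x | x ∈ Ioc (0 : ℝ) 1 ∧ ∀ k ≥ N, (continuant x k : ℝ) ^ β ≤ digit x (k + 1)}

theorem one_le_continuant {x : ℝ} (hx : x ∈ Ioc (0 : ℝ) 1) (k : ℕ) :
    (1 : ℝ) ≤ continuant x k := by
  exact_mod_cast Nat.one_le_two_pow.trans (two_pow_le_continuant hx k)

/-- A limit ratio above `β` forces `a_{n+1} ≥ Q_n ^ β` from some index on. -/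
theorem growthSet_subset_iUnion {α β : ℝ} (h : β < α) (N : ℕ) :
    growthSet α ⊆ ⋃ m, fastSet β (N + m) := by
  rintro x ⟨hx, hlim⟩
  obtain ⟨m, hm⟩ := eventually_atTop.1 (hlim.eventually_const_le h)
  refine mem_iUnion.2 ⟨m, hx, fun k hk => ?_⟩
  have hq : (1 : ℝ) < continuant x k := by
    exact_mod_cast (Nat.one_lt_two_pow (Nat.succ_ne_zero k)).trans_le (two_pow_le_continuant hx k)
  have ha : (0 : ℝ) < digit x (k + 1) := by linarith [two_le_digit hx (k + 1)]
  have h1 := hm k (by omega)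
  rw [le_div_iff₀ (Real.log_pos hq)] at h1
  rw [Real.rpow_le_iff_le_log (by linarith) ha]
  exact h1

/-- The tail of the set past a cylinder lies in an interval at `0` whose length is governed by the
lower bound for the next digit. -/
theorem abs_sub_le_of_mem_codeCylinder {β : ℝ} {N k : ℕ} (hk : N ≤ k) {x y z : ℝ}
    (hx : x ∈ fastSet β N) (hy : y ∈ codeCylinder (fastSet β N) digit k x)
    (hz : z ∈ codeCylinder (fastSet β N) digit k x) :
    |y - z| ≤ 4 * ((continuant x k : ℝ) ^ (-(1 + β)) * (digit x k : ℝ)⁻¹) := by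
  have hq := one_le_continuant hx.1 k
  have ha := two_le_digit hx.1 k
  -- the image under the `(k + 1)`-st iterate is at most `1 / (a_{k+2} - 1) ≤ 2 / a_{k+2}`
  have hbd : ∀ u ∈ codeCylinder (fastSet β N) digit k x, 0 < lurothMap^[k + 1] u ∧
      lurothMap^[k + 1] u ≤ 2 * (continuant x k : ℝ) ^ (-β) := by
    intro u hu
    have hm := iterate_lurothMap_mem hu.1.1 (k + 1)
    refine ⟨hm.1, ?_⟩
    have h1 : ((digit u (k + 1) : ℝ) - 1) * lurothMap^[k + 1] u ≤ 1 :=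
      firstDigit_sub_one_mul_le hm
    have h2 := two_le_digit hu.1.1 (k + 1)
    have h3 := hu.1.2 k hk
    rw [continuant_congr k hu.2] at h3
    have h4 : 0 < (continuant x k : ℝ) ^ β := Real.rpow_pos_of_pos (by linarith) _
    rw [Real.rpow_neg (by linarith), ← div_eq_mul_inv, le_div_iff₀ h4]
    have := hm.1
    nlinarith
  have hyb := hbd y hy
  have hzb := hbd z hz
  have hit := iterate_sub_iterate hy.1.1 hz.1.1 (k + 1) fun i hi => by
    rw [hy.2 i (by omega), hz.2 i (by omega)]
  have hslope : slope y (k + 1) = continuant x k * (digit x k - 1) := by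
    rw [← continuant_congr k hy.2, ← hy.2 k le_rfl, continuant_eq hy.1.1, slope,
      Finset.prod_range_succ, ← slope]
    ring
  have habs : slope y (k + 1) * |y - z| ≤ 2 * (continuant x k : ℝ) ^ (-β) := by
    rw [← abs_of_pos (slope_pos hy.1.1 (k + 1)), ← abs_mul, ← hit, abs_le]
    constructor <;> linarith [hyb.1, hyb.2, hzb.1, hzb.2]
  have hhalf : (continuant x k : ℝ) * (digit x k / 2) ≤ slope y (k + 1) := by
    rw [hslope]
    exact mul_le_mul_of_nonneg_left (by linarith) (by linarith)
  have hpos : (0 : ℝ) < continuant x k * (digit x k / 2) := by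
    apply mul_pos <;> linarith
  have h5 : |y - z| ≤ 2 * (continuant x k : ℝ) ^ (-β) / (continuant x k * (digit x k / 2)) := by
    rw [le_div_iff₀ hpos, mul_comm]
    exact (mul_le_mul_of_nonneg_right hhalf (abs_nonneg _)).trans habs
  refine h5.trans_eq ?_
  rw [neg_add, Real.rpow_add (by linarith), Real.rpow_neg_one]
  field_simp
  ring

/-- The weight of the cylinder of order `k + 1` around `x`: a bound for its diameter within
`fastSet β N`. -/
noncomputable def cylinderBound (β : ℝ) (k : ℕ) (x : ℝ) : ℝ :=
  4 * ((continuant x k : ℝ) ^ (-(1 + β)) * (digit x k : ℝ)⁻¹)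

theorem cylinderBound_pos {β x : ℝ} (hx : x ∈ Ioc (0 : ℝ) 1) (k : ℕ) :
    0 < cylinderBound β k x := by
  have hq := one_le_continuant hx k
  have ha := two_le_digit hx k
  have := Real.rpow_pos_of_pos (show (0 : ℝ) < continuant x k by linarith) (-(1 + β))
  unfold cylinderBound
  positivity

theorem cylinderBound_succ_le {β x : ℝ} (hβ : 0 < β) (hx : x ∈ Ioc (0 : ℝ) 1) (k : ℕ) :
    cylinderBound β (k + 1) x ≤
      cylinderBound β k x * (2 ^ (1 + β) * (digit x (k + 1) : ℝ) ^ (-(2 + β))) := by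
  have hq : (0 : ℝ) < continuant x k := by linarith [one_le_continuant hx k]
  have ha := two_le_digit hx k
  have hb := two_le_digit hx (k + 1)
  have hQ : (continuant x (k + 1) : ℝ) =
      continuant x k * ((digit x k : ℝ) - 1) * digit x (k + 1) := by
    have h : 1 ≤ digit x k := by exact_mod_cast (by linarith : (1 : ℝ) ≤ digit x k)
    rw [continuant]
    push_cast [h]
    ring
  have h1 : ((digit x k : ℝ) - 1) ^ (-(1 + β)) ≤ 2 ^ (1 + β) * (digit x k : ℝ)⁻¹ := by
    calc ((digit x k : ℝ) - 1) ^ (-(1 + β)) ≤ ((digit x k : ℝ) / 2) ^ (-(1 + β)) :=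
          Real.rpow_le_rpow_of_nonpos (by linarith) (by linarith) (by linarith)
      _ = 2 ^ (1 + β) * (digit x k : ℝ) ^ (-(1 + β)) := by
          rw [Real.div_rpow (by linarith) (by norm_num), Real.rpow_neg (by norm_num : (0:ℝ) ≤ 2),
            div_inv_eq_mul, mul_comm]
      _ ≤ 2 ^ (1 + β) * (digit x k : ℝ) ^ (-1 : ℝ) := by
          gcongr
          · linarith
          · linarith
      _ = _ := by rw [Real.rpow_neg_one]
  have h2 : (digit x (k + 1) : ℝ) ^ (-(2 + β)) =
      (digit x (k + 1) : ℝ) ^ (-(1 + β)) * (digit x (k + 1) : ℝ)⁻¹ := by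
    rw [← Real.rpow_neg_one, ← Real.rpow_add (by linarith)]
    ring_nf
  unfold cylinderBound
  rw [hQ, Real.mul_rpow (by apply mul_nonneg <;> linarith) (by linarith),
    Real.mul_rpow (by linarith) (by linarith), h2]
  have h3 : 0 ≤ (continuant x k : ℝ) ^ (-(1 + β)) := Real.rpow_nonneg hq.le _
  have h4 : 0 ≤ (digit x (k + 1) : ℝ) ^ (-(1 + β)) * (digit x (k + 1) : ℝ)⁻¹ := by positivity
  calc _ = 4 * (continuant x k : ℝ) ^ (-(1 + β)) * ((digit x k : ℝ) - 1) ^ (-(1 + β)) *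
        ((digit x (k + 1) : ℝ) ^ (-(1 + β)) * (digit x (k + 1) : ℝ)⁻¹) := by ring
    _ ≤ 4 * (continuant x k : ℝ) ^ (-(1 + β)) * (2 ^ (1 + β) * (digit x k : ℝ)⁻¹) *
        ((digit x (k + 1) : ℝ) ^ (-(1 + β)) * (digit x (k + 1) : ℝ)⁻¹) := by gcongr
    _ = _ := by ring

open scoped ENNReal in
/-- The tails of a convergent `p`-series, with a threshold growing along `k`, are eventually at
most `1` even after multiplication by a constant. -/
theorem exists_tsum_rpow_tail_le_one {p : ℝ} (hp : 1 < p) (C : ℝ) {β : ℝ} (hβ : 0 < β) :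
    ∃ K : ℕ, ∀ k ≥ K, ∀ q : ℝ, (2 : ℝ) ^ k ≤ q →
      ∑' a : ℕ, (if q ^ β ≤ a then ENNReal.ofReal (C * (a : ℝ) ^ (-p)) else 0) ≤ 1 := by
  have hsum : ∑' a : ℕ, ENNReal.ofReal (|C| * (a : ℝ) ^ (-p)) ≠ ⊤ := by
    have h : Summable fun a : ℕ => |C| * (a : ℝ) ^ (-p) :=
      (Real.summable_nat_rpow.2 (by linarith)).mul_left _
    exact h.tsum_ofReal_ne_top
  obtain ⟨M, hM⟩ := eventually_atTop.1
    ((ENNReal.tendsto_sum_nat_add (fun a : ℕ => ENNReal.ofReal (|C| * (a : ℝ) ^ (-p)))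
      hsum).eventually_le_const (show (0 : ℝ≥0∞) < 1 by simp))
  have hlim : Tendsto (fun k : ℕ => ((2 : ℝ) ^ k) ^ β) atTop atTop :=
    (tendsto_rpow_atTop hβ).comp (tendsto_pow_atTop_atTop_of_one_lt (by norm_num))
  obtain ⟨K, hK⟩ := eventually_atTop.1 (hlim.eventually_ge_atTop (M : ℝ))
  refine ⟨K, fun k hk q hq => le_trans ?_ (hM M le_rfl)⟩
  have hMq : (M : ℝ) ≤ q ^ β :=
    (hK k hk).trans (Real.rpow_le_rpow (by positivity) hq hβ.le)
  set f : ℕ → ℝ≥0∞ :=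
    fun a => if q ^ β ≤ a then ENNReal.ofReal (C * (a : ℝ) ^ (-p)) else 0 with hf
  have hzero : ∑ a ∈ Finset.range M, f a = 0 := by
    refine Finset.sum_eq_zero fun a ha => if_neg ?_
    rw [not_le]
    exact lt_of_lt_of_le (by exact_mod_cast Finset.mem_range.1 ha) hMq
  have hsplit : ∑' a, f a = ∑' a, f (a + M) := by
    have h : Summable fun a => f (a + M) := ENNReal.summable
    rw [← h.sum_add_tsum_nat_add', hzero, zero_add]
  rw [hsplit]
  refine ENNReal.tsum_le_tsum fun a => ?_
  simp only [hf]
  split_ifs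
  · refine ENNReal.ofReal_le_ofReal ?_
    exact mul_le_mul_of_nonneg_right (le_abs_self C) (Real.rpow_nonneg (Nat.cast_nonneg _) _)
  · exact zero_le

theorem cylinderBound_le {β x : ℝ} (hβ : 0 < β) (hx : x ∈ Ioc (0 : ℝ) 1) (k : ℕ) :
    cylinderBound β k x ≤ 4 * (1 / 2) ^ k := by
  have hq := one_le_continuant hx k
  have ha := two_le_digit hx k
  have h2 : (2 : ℝ) ^ k ≤ continuant x k := by
    refine le_trans ?_ (show (2 : ℝ) ^ (k + 1) ≤ _ by exact_mod_cast two_pow_le_continuant hx k)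
    exact pow_le_pow_right₀ (by norm_num) (by omega)
  have h3 : (continuant x k : ℝ) ^ (-(1 + β)) ≤ (1 / 2) ^ k := by
    calc (continuant x k : ℝ) ^ (-(1 + β)) ≤ (continuant x k : ℝ) ^ (-1 : ℝ) :=
          Real.rpow_le_rpow_of_exponent_le hq (by linarith)
      _ = (continuant x k : ℝ)⁻¹ := Real.rpow_neg_one _
      _ ≤ ((2 : ℝ) ^ k)⁻¹ := inv_anti₀ (by positivity) h2
      _ = (1 / 2) ^ k := by simp
  have h4 : (digit x k : ℝ)⁻¹ ≤ 1 := inv_le_one_of_one_le₀ (by linarith)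
  unfold cylinderBound
  have h5 : 0 ≤ (digit x k : ℝ)⁻¹ := by positivity
  have h6 : (0 : ℝ) ≤ (1 / 2) ^ k := by positivity
  nlinarith [mul_le_mul h3 h4 h5 h6]

theorem exists_dimH_fastSet_le {β s : ℝ} (hβ : 0 < β) (hs : 1 / (2 + β) < s) :
    ∃ K, ∀ N ≥ K, dimH (fastSet β N) ≤ ENNReal.ofReal s := by
  have hs0 : 0 < s := lt_trans (by positivity) hs
  have hp : 1 < (2 + β) * s := by
    rw [div_lt_iff₀ (by linarith)] at hs
    linarith
  obtain ⟨K, hK⟩ := exists_tsum_rpow_tail_le_one hp (((2 : ℝ) ^ (1 + β)) ^ s) hβ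
  refine ⟨K, fun N hN => ?_⟩
  set E := fastSet β N with hE
  set w : ℕ → ℝ → ℕ → ENNReal := fun k x a => if (continuant x k : ℝ) ^ β ≤ a then
    ENNReal.ofReal (((2 : ℝ) ^ (1 + β)) ^ s * (a : ℝ) ^ (-((2 + β) * s))) else 0 with hw
  have hediam : ∀ k ≥ N, ∀ x ∈ E,
      Metric.ediam (codeCylinder E digit k x) ≤ ENNReal.ofReal (cylinderBound β k x) := by
    intro k hk x hx
    refine Metric.ediam_le fun y hy z hz => ?_
    rw [edist_dist, Real.dist_eq]
    exact ENNReal.ofReal_le_ofReal (abs_sub_le_of_mem_codeCylinder hk hx hy hz)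
  have hfin : ∀ x ∈ E, μH[s] (codeCylinder E digit N x) ≠ ⊤ := by
    intro x hx
    refine ne_top_of_le_ne_top ENNReal.ofReal_ne_top (hausdorffMeasure_codeCylinder_le
      (J := fun k x => ENNReal.ofReal (cylinderBound β k x ^ s)) (w := w)
      (δ := fun k => ENNReal.ofReal (4 * (1 / 2) ^ k)) (N := N) ?_ ?_ ?_ ?_ ?_ hx le_rfl)
    · rw [← ENNReal.ofReal_zero]
      refine (ENNReal.continuous_ofReal.tendsto 0).comp ?_
      simpa using (tendsto_pow_atTop_nhds_zero_of_lt_one (r := (1 / 2 : ℝ)) (by norm_num)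
        (by norm_num)).const_mul 4
    · exact fun k hk x hx => (hediam k hk x hx).trans
        (ENNReal.ofReal_le_ofReal (cylinderBound_le hβ hx.1 k))
    · intro k hk x hx
      rw [← ENNReal.ofReal_rpow_of_nonneg (cylinderBound_pos hx.1 k).le hs0.le]
      exact ENNReal.rpow_le_rpow (hediam k hk x hx) hs0.le
    · intro k hk x hx y hy
      have hb := hy.1.2 k hk
      rw [continuant_congr k hy.2] at hb
      simp only [hw]
      rw [if_pos hb, ← ENNReal.ofReal_mul (by have := cylinderBound_pos (β := β) hx.1 k; positivity)]
      refine ENNReal.ofReal_le_ofReal ?_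
      have hxy : cylinderBound β k y = cylinderBound β k x := by
        unfold cylinderBound
        rw [continuant_congr k hy.2, hy.2 k le_rfl]
      have h1 := cylinderBound_succ_le hβ hy.1.1 k
      rw [hxy] at h1
      have h2 := two_le_digit hy.1.1 (k + 1)
      refine (Real.rpow_le_rpow (cylinderBound_pos hy.1.1 _).le h1 hs0.le).trans_eq ?_
      rw [Real.mul_rpow (cylinderBound_pos hx.1 k).le (by positivity),
        Real.mul_rpow (by positivity) (by positivity), ← Real.rpow_mul (by linarith) (-(2 + β)),
        neg_mul]
    · intro k hk x hx
      refine hK k (by omega) _ ?_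
      refine le_trans ?_ (show (2 : ℝ) ^ (k + 1) ≤ _ by
        exact_mod_cast two_pow_le_continuant hx.1 k)
      exact pow_le_pow_right₀ (by norm_num) (by omega)
  have hcover : E ⊆ ⋃ v : Fin (N + 1) → ℕ, {y ∈ E | ∀ i : Fin (N + 1), digit y i = v i} :=
    fun y hy => mem_iUnion.2 ⟨fun i => digit y i, hy, fun _ => rfl⟩
  refine (dimH_mono hcover).trans ?_
  rw [dimH_iUnion]
  refine iSup_le fun v => ?_
  rcases Set.eq_empty_or_nonempty {y ∈ E | ∀ i : Fin (N + 1), digit y i = v i} with h | ⟨x, hx⟩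
  · rw [h]; simp
  · have hsub : {y ∈ E | ∀ i : Fin (N + 1), digit y i = v i} ⊆ codeCylinder E digit N x :=
      fun y hy => ⟨hy.1, fun i hi => by
        rw [show i = ((⟨i, by omega⟩ : Fin (N + 1)) : ℕ) from rfl, hy.2, hx.2]⟩
    refine (dimH_mono hsub).trans ?_
    have := dimH_le_of_hausdorffMeasure_ne_top (d := s.toNNReal)
      (by rw [Real.coe_toNNReal s hs0.le]; exact hfin x hx.1)
    exact this

theorem dimH_growthSet_le {β : ℝ} (hβ : 0 < β) :
    dimH (growthSet β) ≤ ENNReal.ofReal (1 / (2 + β)) := by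
  have main : ∀ γ ∈ Ioo 0 β, dimH (growthSet β) ≤ ENNReal.ofReal (1 / (2 + γ)) := by
    intro γ hγ
    -- shrink the exponent once more, to have strict inequality in the dimension bound
    have hγ' : 1 / (2 + (γ + β) / 2) < 1 / (2 + γ) :=
      one_div_lt_one_div_of_lt (by linarith [hγ.1]) (by linarith [hγ.2])
    obtain ⟨K, hK⟩ := exists_dimH_fastSet_le (by linarith [hγ.1, hγ.2]) hγ'
    refine (dimH_mono (growthSet_subset_iUnion (show (γ + β) / 2 < β by linarith [hγ.2]) K)).trans ?_
    rw [dimH_iUnion]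
    exact iSup_le fun m => hK _ (by omega)
  have hcont : Tendsto (fun γ : ℝ => ENNReal.ofReal (1 / (2 + γ))) (𝓝[<] β)
      (𝓝 (ENNReal.ofReal (1 / (2 + β)))) := by
    refine (ENNReal.continuous_ofReal.tendsto _).comp (tendsto_nhdsWithin_of_tendsto_nhds ?_)
    exact tendsto_const_nhds.div (tendsto_const_nhds.add tendsto_id) (by simp; linarith)
  exact ge_of_tendsto hcont (eventually_of_mem (Ioo_mem_nhdsLT hβ) main)

/-! ### Points with prescribed digits -/

theorem firstDigit_eq_and_lurothMap_eq {d : ℕ} (hd : 2 ≤ d) {x y : ℝ} (hy : y ∈ Ioc (0 : ℝ) 1)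
    (h : x = 1 / d + y / (d * (d - 1))) : firstDigit x = d ∧ lurothMap x = y := by
  have hd' : (2 : ℝ) ≤ d := by exact_mod_cast hd
  have h0 : (0 : ℝ) < d * (d - 1) := mul_pos (by linarith) (by linarith)
  have hx : x * (d * (d - 1)) = (d - 1) + y := by
    have : (d : ℝ) - 1 ≠ 0 := by linarith
    rw [h]
    field_simp
  have hx0 : 0 < x := by
    have := hy.1
    rw [h]
    positivity
  have hfirst : firstDigit x = d := by
    have : ⌊1 / x⌋₊ = d - 1 := by
      rw [Nat.floor_eq_iff (by positivity)]
      push_cast [show 1 ≤ d by omega]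
      rw [le_div_iff₀ hx0, div_lt_iff₀ hx0]
      have := hy.1
      have := hy.2
      constructor <;> nlinarith
    unfold firstDigit
    omega
  refine ⟨hfirst, ?_⟩
  have hx1 : x ≤ 1 := by
    have := hy.2
    nlinarith
  rw [lurothMap_eq ⟨hx0, hx1⟩, hfirst]
  linarith

/-- The Lüroth series of the digit sequence `a n, a (n + 1), …`, truncated after `k` terms. -/
noncomputable def truncatedSeries (a : ℕ → ℕ) : ℕ → ℕ → ℝ
  | 0, _ => 0
  | k + 1, n => 1 / a n + truncatedSeries a k (n + 1) / (a n * (a n - 1))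

theorem exists_tails {a : ℕ → ℕ} (ha : ∀ n, 2 ≤ a n) :
    ∃ x : ℕ → ℝ, ∀ n, x n ∈ Ioc (0 : ℝ) 1 ∧ x n = 1 / a n + x (n + 1) / (a n * (a n - 1)) := by
  have ha' : ∀ n, (2 : ℝ) ≤ a n := fun n => by exact_mod_cast ha n
  have hpos : ∀ n, (0 : ℝ) < a n * (a n - 1) := fun n =>
    mul_pos (by linarith [ha' n]) (by linarith [ha' n])
  have hbd : ∀ k n, truncatedSeries a k n ∈ Icc (0 : ℝ) 1 := by
    intro k
    induction k with
    | zero => intro n; simp [truncatedSeries]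
    | succ k ih =>
      intro n
      have h1 := ih (n + 1)
      have h2 := ha' n
      have h3 : (a n : ℝ) - 1 ≠ 0 := by linarith
      have h4 : (a n : ℝ) ≠ 0 := by linarith
      have : truncatedSeries a (k + 1) n * (a n * (a n - 1)) =
          (a n - 1) + truncatedSeries a k (n + 1) := by
        rw [truncatedSeries]
        field_simp
      constructor
      · exact nonneg_of_mul_nonneg_left (by rw [this]; linarith [h1.1]) (hpos n)
      · have := h1.2
        have := hpos n
        nlinarith
  have hmono : ∀ k n, truncatedSeries a k n ≤ truncatedSeries a (k + 1) n := by
    intro k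
    induction k with
    | zero => intro n; exact (hbd 1 n).1
    | succ k ih =>
      intro n
      rw [truncatedSeries, truncatedSeries]
      gcongr
      · exact (hpos n).le
      · exact ih (n + 1)
  have hlim : ∀ n, ∃ x, Tendsto (fun k => truncatedSeries a k n) atTop (𝓝 x) := fun n =>
    ⟨_, tendsto_atTop_ciSup (monotone_nat_of_le_succ fun k => hmono k n)
      ⟨1, by rintro _ ⟨k, rfl⟩; exact (hbd k n).2⟩⟩
  choose x hx using hlim
  have hrec : ∀ n, x n = 1 / a n + x (n + 1) / (a n * (a n - 1)) := fun n =>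
    tendsto_nhds_unique ((hx n).comp (tendsto_add_atTop_nat 1))
      (((hx (n + 1)).div_const _).const_add _)
  refine ⟨x, fun n => ⟨⟨?_, le_of_tendsto' (hx n) fun k => (hbd k n).2⟩, hrec n⟩⟩
  have h0 : 0 ≤ x (n + 1) := ge_of_tendsto' (hx (n + 1)) fun k => (hbd k _).1
  have h1 : (0 : ℝ) < 1 / a n := by have := ha' n; positivity
  rw [hrec n]
  have := div_nonneg h0 (hpos n).le
  linarith

/-- Every sequence of integers `≥ 2` is the digit sequence of a point of `(0, 1]`. -/
theorem exists_digit_eq {a : ℕ → ℕ} (ha : ∀ n, 2 ≤ a n) :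
    ∃ x ∈ Ioc (0 : ℝ) 1, ∀ n, digit x n = a n := by
  obtain ⟨x, hx⟩ := exists_tails ha
  have hb := fun n => firstDigit_eq_and_lurothMap_eq (ha n) (hx (n + 1)).1 (hx n).2
  have hit : ∀ n, lurothMap^[n] (x 0) = x n := by
    intro n
    induction n with
    | zero => rfl
    | succ n ih => rw [Function.iterate_succ_apply', ih, (hb n).2]
  exact ⟨x 0, (hx 0).1, fun n => by rw [digit, hit, (hb n).1]⟩

/-- Separation of two points at their first differing digit. A digit `≥ 3` after it keeps the point
with the larger digit away from the right end of its cylinder, so that the gap is comparable with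
the distance of the cylinders' left ends. -/
theorem separation {x y : ℝ} (hx : x ∈ Ioc (0 : ℝ) 1) (hy : y ∈ Ioc (0 : ℝ) 1) {n : ℕ}
    (h : ∀ i < n, digit x i = digit y i) (hlt : digit x n < digit y n)
    (h3 : 3 ≤ digit y (n + 1)) :
    ((digit y n : ℝ) - digit x n) ≤
      2 * (digit x n * digit y n) * (slope x n * (x - y)) := by
  rw [← iterate_sub_iterate hx hy n h]
  have hu := iterate_lurothMap_mem hx n
  have hv := iterate_lurothMap_mem hy n
  have hw := iterate_lurothMap_mem hy (n + 1)
  have hab : (digit x n : ℝ) + 1 ≤ digit y n := by exact_mod_cast hlt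
  have h3' : (3 : ℝ) ≤ digit y (n + 1) := by exact_mod_cast h3
  have ha := two_le_digit hx n
  have h1 : 1 < (digit x n : ℝ) * lurothMap^[n] x := one_lt_firstDigit_mul hu
  have h2 : ((digit y (n + 1) : ℝ) - 1) * lurothMap^[n + 1] y ≤ 1 := firstDigit_sub_one_mul_le hw
  have h4 : lurothMap^[n + 1] y ≤ 1 / 2 := by nlinarith [hw.1]
  rw [iterate_lurothMap_succ hy] at h4
  set u := lurothMap^[n] x
  set v := lurothMap^[n] y
  set a : ℝ := (digit x n : ℝ)
  set b : ℝ := (digit y n : ℝ)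
  have h5 : 2 * (a * b) * (u - v) = 2 * b * (a * u) - 2 * (a * (b * v)) := by ring
  -- `(b - 1) b v ≤ b - 1 / 2` and `a ≤ b - 1`
  have h6 : a * (b * v) ≤ a + 1 / 2 := by
    have h7 : (b - 1) * (b * v) ≤ (b - 1) + 1 / 2 := by linarith
    have h8 : (b - 1) * (a * (b * v)) ≤ (b - 1) * (a + 1 / 2) := by nlinarith
    exact le_of_mul_le_mul_left h8 (by linarith)
  rw [h5]
  nlinarith

/-! ### Cantor series -/

/-- The remainders of the greedy Cantor expansion of `t` to the bases `A 0, A 1, …`. -/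
noncomputable def cantorRem (A : ℕ → ℕ) (t : ℝ) : ℕ → ℝ
  | 0 => t
  | n + 1 => Int.fract (A n * cantorRem A t n)

/-- The digits of the Cantor expansion of `t` to the bases `A 0, A 1, …`. -/
noncomputable def cantorDigit (A : ℕ → ℕ) (t : ℝ) (n : ℕ) : ℕ := ⌊A n * cantorRem A t n⌋₊

theorem cantorRem_mem (A : ℕ → ℕ) {t : ℝ} (ht : t ∈ Ico (0 : ℝ) 1) (n : ℕ) :
    cantorRem A t n ∈ Ico (0 : ℝ) 1 := by
  cases n with
  | zero => exact ht
  | succ n => exact ⟨Int.fract_nonneg _, Int.fract_lt_one _⟩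

theorem cantorDigit_lt {A : ℕ → ℕ} (hA : ∀ n, 0 < A n) {t : ℝ} (ht : t ∈ Ico (0 : ℝ) 1) (n : ℕ) :
    cantorDigit A t n < A n := by
  have h := cantorRem_mem A ht n
  have hA' : (0 : ℝ) < A n := by exact_mod_cast hA n
  rw [cantorDigit, Nat.floor_lt (mul_nonneg hA'.le h.1)]
  nlinarith [h.2]

theorem cantorDigit_add_cantorRem (A : ℕ → ℕ) {t : ℝ} (ht : t ∈ Ico (0 : ℝ) 1) (n : ℕ) :
    A n * cantorRem A t n = cantorDigit A t n + cantorRem A t (n + 1) := by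
  have h : 0 ≤ (A n : ℝ) * cantorRem A t n :=
    mul_nonneg (Nat.cast_nonneg _) (cantorRem_mem A ht n).1
  rw [cantorDigit, cantorRem, natCast_floor_eq_intCast_floor h, Int.floor_add_fract]

theorem cantorRem_sub {A : ℕ → ℕ} {t u : ℝ} (ht : t ∈ Ico (0 : ℝ) 1) (hu : u ∈ Ico (0 : ℝ) 1)
    (n : ℕ) (h : ∀ i < n, cantorDigit A t i = cantorDigit A u i) :
    cantorRem A t n - cantorRem A u n = (∏ i ∈ Finset.range n, (A i : ℝ)) * (t - u) := by
  induction n with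
  | zero => simp [cantorRem]
  | succ n ih =>
    have h1 := cantorDigit_add_cantorRem A ht n
    have h2 := cantorDigit_add_cantorRem A hu n
    have h3 := ih fun i hi => h i (by omega)
    rw [h n (by omega)] at h1
    rw [Finset.prod_range_succ]
    linear_combination (A n : ℝ) * h3 + h2 - h1

theorem eq_of_cantorDigit_eq {A : ℕ → ℕ} (hA : ∀ n, 2 ≤ A n) {t u : ℝ} (ht : t ∈ Ico (0 : ℝ) 1)
    (hu : u ∈ Ico (0 : ℝ) 1) (h : ∀ n, cantorDigit A t n = cantorDigit A u n) : t = u := by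
  have hbd : ∀ n : ℕ, |t - u| ≤ (1 / 2) ^ n := by
    intro n
    have h1 := cantorRem_sub ht hu n fun i _ => h i
    have h2 : (2 : ℝ) ^ n ≤ ∏ i ∈ Finset.range n, (A i : ℝ) := by
      calc (2 : ℝ) ^ n = ∏ i ∈ Finset.range n, (2 : ℝ) := by simp
        _ ≤ _ := Finset.prod_le_prod (fun _ _ => by norm_num) fun i _ => by exact_mod_cast hA i
    have h3 := cantorRem_mem A ht n
    have h4 := cantorRem_mem A hu n
    have h5 : (∏ i ∈ Finset.range n, (A i : ℝ)) * |t - u| ≤ 1 := by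
      rw [← abs_of_nonneg (show (0 : ℝ) ≤ ∏ i ∈ Finset.range n, (A i : ℝ) by positivity),
        ← abs_mul, ← h1, abs_le]
      constructor <;> linarith [h3.1, h3.2, h4.1, h4.2]
    rw [one_div, inv_pow, ← one_div, le_div_iff₀ (by positivity), mul_comm]
    exact (mul_le_mul_of_nonneg_right h2 (abs_nonneg _)).trans h5
  have h0 : |t - u| ≤ 0 := ge_of_tendsto'
    (tendsto_pow_atTop_nhds_zero_of_lt_one (by norm_num) (by norm_num)) hbd
  exact sub_eq_zero.1 (abs_eq_zero.1 (le_antisymm h0 (abs_nonneg _)))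

theorem abs_sub_le_of_cantorDigit_lt {A : ℕ → ℕ} {t u : ℝ} (ht : t ∈ Ico (0 : ℝ) 1)
    (hu : u ∈ Ico (0 : ℝ) 1) {n : ℕ} (h : ∀ i < n, cantorDigit A t i = cantorDigit A u i)
    (hlt : cantorDigit A t n < cantorDigit A u n) :
    (∏ i ∈ Finset.range (n + 1), (A i : ℝ)) * |t - u| ≤
      2 * ((cantorDigit A u n : ℝ) - cantorDigit A t n) := by
  have h1 := cantorRem_sub ht hu n h
  have h2 := cantorDigit_add_cantorRem A ht n
  have h3 := cantorDigit_add_cantorRem A hu n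
  have h4 := cantorRem_mem A ht (n + 1)
  have h5 := cantorRem_mem A hu (n + 1)
  have h6 : (cantorDigit A t n : ℝ) + 1 ≤ cantorDigit A u n := by exact_mod_cast hlt
  rw [← abs_of_nonneg (show (0 : ℝ) ≤ ∏ i ∈ Finset.range (n + 1), (A i : ℝ) by positivity),
    ← abs_mul, show (∏ i ∈ Finset.range (n + 1), (A i : ℝ)) * (t - u) =
      ((cantorDigit A t n : ℝ) + cantorRem A t (n + 1)) -
        (cantorDigit A u n + cantorRem A u (n + 1)) by
      rw [Finset.prod_range_succ]; linear_combination (-(A n : ℝ)) * h1 + h2 - h3, abs_le]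
  constructor <;> linarith [h4.1, h4.2, h5.1, h5.2]

/-! ### A lower bound for Hausdorff dimension -/

/-- If the inverse of a parametrization by the unit interval is `r`-Hölder continuous, the image has
dimension at least `r`. -/
theorem ofReal_le_dimH_image {g : ℝ → ℝ} {C r : ℝ} (hr : 0 < r)
    (h : ∀ t ∈ Ico (0 : ℝ) 1, ∀ u ∈ Ico (0 : ℝ) 1, |t - u| ≤ C * |g t - g u| ^ r) :
    ENNReal.ofReal r ≤ dimH (g '' Ico (0 : ℝ) 1) := by
  set T := Ico (0 : ℝ) 1 with hT
  have hinj : InjOn g T := by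
    intro t ht u hu htu
    have := h t ht u hu
    rw [htu, sub_self, abs_zero, Real.zero_rpow hr.ne', mul_zero] at this
    exact sub_eq_zero.1 (abs_eq_zero.1 (le_antisymm this (abs_nonneg _)))
  have hleft : LeftInvOn (Function.invFunOn g T) g T := hinj.leftInvOn_invFunOn
  have hholder : HolderOnWith C.toNNReal r.toNNReal (Function.invFunOn g T) (g '' T) := by
    rintro _ ⟨t, ht, rfl⟩ _ ⟨u, hu, rfl⟩
    rw [hleft ht, hleft hu, edist_dist, edist_dist, Real.dist_eq, Real.dist_eq,
      Real.coe_toNNReal r hr.le, ENNReal.ofReal_rpow_of_nonneg (abs_nonneg _) hr.le,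
      show ((C.toNNReal : NNReal) : ENNReal) = ENNReal.ofReal C from rfl,
      ← ENNReal.ofReal_mul' (by positivity)]
    exact ENNReal.ofReal_le_ofReal (h t ht u hu)
  have hdim := hholder.dimH_image_le (Real.toNNReal_pos.2 hr)
  rw [hleft.image_image, Real.dimH_of_nonempty_interior
    (by rw [hT, interior_Ico]; exact nonempty_Ioo.2 one_pos)] at hdim
  simp only [Module.finrank_self, Nat.cast_one] at hdim
  rw [ENNReal.le_div_iff_mul_le (Or.inl (by simpa using hr)) (Or.inl (by simp)), one_mul] at hdim
  exact hdim

/-! ### Digits of doubly exponential size -/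

theorem tendsto_natCast_add_div_pow {l : ℝ} (hl : 1 < l) (a b : ℝ) :
    Tendsto (fun n : ℕ => (a * n + b) / l ^ n) atTop (𝓝 0) := by
  have h1 := (tendsto_pow_const_div_const_pow_of_one_lt 1 hl).const_mul a
  have h2 := (tendsto_pow_const_div_const_pow_of_one_lt 0 hl).const_mul b
  refine ((h1.add h2).congr fun n => ?_).trans_eq (by simp)
  rw [pow_one, pow_zero]
  ring

/-- If `log a_n` is `l ^ n` up to a bounded error, then `log Q_n` is the sum of `l ^ n` and
`2 (1 + l + ⋯ + l ^ (n - 1))` up to a linear error, and `log a_{n+1} / log Q_n` tends to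
`l (l - 1) / (l + 1)`. -/
theorem mem_growthSet {β l x : ℝ} (hl : 1 < l) (hlβ : l ^ 2 = (1 + β) * l + β)
    (hx : x ∈ Ioc (0 : ℝ) 1) (h1 : ∀ n, Real.exp (l ^ n) ≤ digit x n)
    (h2 : ∀ n, (digit x n : ℝ) ≤ 4 * Real.exp (l ^ n)) : x ∈ growthSet β := by
  refine ⟨hx, ?_⟩
  have hl0 : 0 < l - 1 := by linarith
  have hlog4 : Real.log 4 ≤ 2 := by
    rw [show (4 : ℝ) = 2 ^ 2 by norm_num, Real.log_pow]
    have := Real.log_two_lt_d9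
    push_cast
    linarith
  have hlog2 : Real.log 2 ≤ 2 := by linarith [Real.log_two_lt_d9]
  have hd : ∀ n, |Real.log (digit x n) - l ^ n| ≤ 2 := by
    intro n
    have h3 := two_le_digit hx n
    have h4 := Real.log_le_log (Real.exp_pos _) (h1 n)
    have h5 := Real.log_le_log (by linarith) (h2 n)
    rw [Real.log_exp] at h4
    rw [Real.log_mul (by norm_num) (Real.exp_pos _).ne', Real.log_exp] at h5
    rw [abs_le]
    constructor <;> linarith
  have hd' : ∀ n, |Real.log ((digit x n : ℝ) - 1) - l ^ n| ≤ 2 := by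
    intro n
    have h3 := two_le_digit hx n
    have h4 := Real.log_le_log (y := (digit x n : ℝ) - 1) (by positivity)
      (show Real.exp (l ^ n) / 2 ≤ _ by linarith [h1 n])
    have h5 := Real.log_le_log (by linarith)
      (show (digit x n : ℝ) - 1 ≤ 4 * Real.exp (l ^ n) by linarith [h2 n])
    rw [Real.log_div (Real.exp_pos _).ne' (by norm_num), Real.log_exp] at h4
    rw [Real.log_mul (by norm_num) (Real.exp_pos _).ne', Real.log_exp] at h5
    rw [abs_le]
    constructor <;> linarith
  have hQ : ∀ k : ℕ, |Real.log (continuant x k) -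
      (2 * ((l ^ k - 1) / (l - 1)) + l ^ k)| ≤ 4 * k + 2 := by
    intro k
    induction k with
    | zero => simpa [continuant] using hd 0
    | succ k ih =>
      have h3 := two_le_digit hx k
      have h4 := two_le_digit hx (k + 1)
      have h5 := one_le_continuant hx k
      have hk : 1 ≤ digit x k := by exact_mod_cast (by linarith : (1 : ℝ) ≤ digit x k)
      rw [continuant]
      push_cast [hk]
      rw [Real.log_mul (by apply mul_ne_zero <;> linarith) (by linarith),
        Real.log_mul (by linarith) (by linarith)]
      have h6 : 2 * ((l ^ (k + 1) - 1) / (l - 1)) + l ^ (k + 1) =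
          (2 * ((l ^ k - 1) / (l - 1)) + l ^ k) + l ^ k + l ^ (k + 1) := by
        field_simp
        ring
      rw [h6]
      have h7 := abs_le.1 ih
      have h8 := abs_le.1 (hd' k)
      have h9 := abs_le.1 (hd (k + 1))
      rw [abs_le]
      constructor <;> linarith [h7.1, h7.2, h8.1, h8.2, h9.1, h9.2]
  have hnum : Tendsto (fun k : ℕ => Real.log (digit x (k + 1)) / l ^ k) atTop (𝓝 l) := by
    rw [tendsto_iff_dist_tendsto_zero]
    refine squeeze_zero (fun _ => dist_nonneg) (fun k => ?_)
      (tendsto_natCast_add_div_pow hl 0 2)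
    have hp : (0 : ℝ) < l ^ k := by positivity
    rw [Real.dist_eq, show Real.log (digit x (k + 1)) / l ^ k - l =
      (Real.log (digit x (k + 1)) - l ^ (k + 1)) / l ^ k by field_simp; ring, abs_div, abs_of_pos hp]
    gcongr
    simpa using hd (k + 1)
  have hden : Tendsto (fun k : ℕ => Real.log (continuant x k) / l ^ k) atTop
      (𝓝 (2 / (l - 1) + 1)) := by
    rw [tendsto_iff_dist_tendsto_zero]
    refine squeeze_zero (fun _ => dist_nonneg) (fun k => ?_)
      (tendsto_natCast_add_div_pow hl 4 (2 + 2 / (l - 1)))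
    have hp : (0 : ℝ) < l ^ k := by positivity
    rw [Real.dist_eq, show Real.log (continuant x k) / l ^ k - (2 / (l - 1) + 1) =
      ((Real.log (continuant x k) - (2 * ((l ^ k - 1) / (l - 1)) + l ^ k)) - 2 / (l - 1)) / l ^ k by
      field_simp; ring, abs_div, abs_of_pos hp]
    gcongr
    refine (abs_sub _ _).trans ?_
    rw [abs_of_pos (show 0 < 2 / (l - 1) by positivity)]
    linarith [hQ k]
  have hdiv := hnum.div hden (by positivity)
  have hβ : l / (2 / (l - 1) + 1) = β := by
    have : (2 / (l - 1) + 1) = (l + 1) / (l - 1) := by field_simp; ring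
    rw [this, div_div_eq_mul_div, div_eq_iff (by linarith)]
    linarith
  rw [hβ] at hdiv
  refine hdiv.congr fun k => ?_
  have hp : l ^ k ≠ 0 := by positivity
  simp only [Pi.div_apply]
  exact div_div_div_cancel_right₀ hp _ _

/-- The exponent `(1 - r) l ^ n + (2 r - 1) (1 + l + ⋯ + l ^ n)` is, for `r < 1 / (1 + l)`, a
negative multiple of `l ^ n` up to a constant, hence beats any geometric growth. -/
theorem exists_bound_geometric_mul_exp {l r : ℝ} (hl : 1 < l) (hr : r < 1 / (1 + l)) :
    ∃ C, ∀ n : ℕ, 16 ^ n *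
      Real.exp ((1 - r) * l ^ n + (2 * r - 1) * ∑ i ∈ Finset.range (n + 1), l ^ i) ≤ C := by
  have hl0 : 0 < l - 1 := by linarith
  have hr' : r * (1 + l) < 1 := by rwa [lt_div_iff₀ (by linarith)] at hr
  set δ := (1 - r * (1 + l)) / (l - 1) with hδ
  have hδ0 : 0 < δ := div_pos (by linarith) hl0
  set b := (1 - 2 * r) / (l - 1) with hb
  have heq : ∀ n : ℕ, 16 ^ n *
      Real.exp ((1 - r) * l ^ n + (2 * r - 1) * ∑ i ∈ Finset.range (n + 1), l ^ i) =
      Real.exp (Real.log 16 * n + b - δ * l ^ n) := by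
    intro n
    have h16 : (16 : ℝ) ^ n = Real.exp (Real.log 16 * n) := by
      rw [mul_comm, Real.exp_nat_mul, Real.exp_log (by norm_num)]
    rw [h16, ← Real.exp_add, geom_sum_eq hl.ne', hδ, hb]
    congr 1
    field_simp
    ring
  have hev : ∀ᶠ n : ℕ in atTop,
      Real.exp (Real.log 16 * n + b - δ * l ^ n) ≤ 1 := by
    filter_upwards [(tendsto_natCast_add_div_pow hl (Real.log 16) b).eventually_le_const hδ0]
      with n hn
    rw [div_le_iff₀ (by positivity)] at hn
    exact Real.exp_le_one_iff.2 (by linarith)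
  have hbdd : BddAbove (range fun n : ℕ => Real.exp (Real.log 16 * n + b - δ * l ^ n)) :=
    IsBoundedUnder.bddAbove_range ⟨1, by simpa using hev⟩
  obtain ⟨C, hC⟩ := hbdd
  exact ⟨C, fun n => (heq n).trans_le (hC ⟨n, rfl⟩)⟩

/-- From a separation of order `j / U ^ 2` in the image and a distance of order `j / U` in the
parameter, with `U = exp S`, to a Hölder inequality. -/
theorem holder_of_separation {j B S L r C D X : ℝ} (hj : 1 ≤ j) (hjL : j ≤ 2 * Real.exp L)
    (hB : 1 ≤ B) (hr0 : 0 < r) (hr1 : r < 1)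
    (hC : 4 * B * Real.exp ((1 - r) * L + (2 * r - 1) * S) ≤ C)
    (hD : Real.exp S * D ≤ 2 * j) (hX : j ≤ B * Real.exp (2 * S) * X) : D ≤ C * X ^ r := by
  have hj0 : 0 < j := by linarith
  have hX0 : 0 < X := by
    have : 0 < B * Real.exp (2 * S) := by positivity
    exact pos_of_mul_pos_right (hj0.trans_le hX) this.le
  have h1 : j ^ r ≤ B * Real.exp (2 * r * S) * X ^ r := by
    calc j ^ r ≤ (B * Real.exp (2 * S) * X) ^ r := Real.rpow_le_rpow hj0.le hX hr0.le
      _ = B ^ r * Real.exp (2 * r * S) * X ^ r := by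
        rw [Real.mul_rpow (by positivity) hX0.le, Real.mul_rpow (by positivity) (by positivity),
          ← Real.exp_mul]
        ring_nf
      _ ≤ B * Real.exp (2 * r * S) * X ^ r := by
        gcongr
        exact (Real.rpow_le_rpow_of_exponent_le hB hr1.le).trans_eq (Real.rpow_one B)
  have h2 : j ^ (1 - r) ≤ 2 * Real.exp ((1 - r) * L) := by
    calc j ^ (1 - r) ≤ (2 * Real.exp L) ^ (1 - r) :=
          Real.rpow_le_rpow hj0.le hjL (by linarith)
      _ = 2 ^ (1 - r) * Real.exp ((1 - r) * L) := by
        rw [Real.mul_rpow (by norm_num) (by positivity), ← Real.exp_mul, mul_comm L]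
      _ ≤ 2 * Real.exp ((1 - r) * L) := by
        gcongr
        exact (Real.rpow_le_rpow_of_exponent_le (by norm_num) (by linarith)).trans_eq
          (Real.rpow_one 2)
  have hjj : j = j ^ r * j ^ (1 - r) := by rw [← Real.rpow_add hj0]; simp
  have h3 : D ≤ Real.exp (-S) * (2 * j) := by
    rw [Real.exp_neg, ← div_eq_inv_mul, le_div_iff₀ (Real.exp_pos _), mul_comm]
    exact hD
  calc D ≤ Real.exp (-S) * (2 * j) := h3
    _ = Real.exp (-S) * (2 * (j ^ r * j ^ (1 - r))) := by rw [← hjj]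
    _ ≤ Real.exp (-S) * (2 * ((B * Real.exp (2 * r * S) * X ^ r) *
          (2 * Real.exp ((1 - r) * L)))) := by gcongr
    _ = 4 * B * (Real.exp (-S) * Real.exp (2 * r * S) * Real.exp ((1 - r) * L)) * X ^ r := by ring
    _ = 4 * B * Real.exp ((1 - r) * L + (2 * r - 1) * S) * X ^ r := by
        rw [← Real.exp_add, ← Real.exp_add]
        ring_nf
    _ ≤ C * X ^ r := by gcongr

theorem ofReal_le_dimH_growthSet {β l r : ℝ} (hl : 1 < l) (hlβ : l ^ 2 = (1 + β) * l + β)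
    (hr0 : 0 < r) (hr : r < 1 / (1 + l)) : ENNReal.ofReal r ≤ dimH (growthSet β) := by
  have hr1 : r < 1 := hr.trans (by rw [div_lt_one (by linarith)]; linarith)
  set A : ℕ → ℕ := fun n => ⌈Real.exp (l ^ n)⌉₊ with hAdef
  have hA1 : ∀ n, Real.exp (l ^ n) ≤ A n := fun n => Nat.le_ceil _
  have hone : ∀ n : ℕ, 1 ≤ Real.exp (l ^ n) := fun n => Real.one_le_exp (by positivity)
  have hA2 : ∀ n, (A n : ℝ) ≤ 2 * Real.exp (l ^ n) := fun n => by
    have := Nat.ceil_lt_add_one (Real.exp_pos (l ^ n)).le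
    linarith [hone n]
  have hA3 : ∀ n, 3 ≤ A n := fun n => by
    have h1 : Real.exp 1 ≤ Real.exp (l ^ n) := Real.exp_le_exp.2 (one_le_pow₀ hl.le)
    have h2 : (2 : ℝ) < A n := by linarith [hA1 n, Real.exp_one_gt_d9]
    exact_mod_cast h2
  choose g hg hgd using fun t : ℝ => exists_digit_eq (a := fun n => A n + cantorDigit A t n)
    fun n => by have := hA3 n; omega
  have hlow : ∀ t n, Real.exp (l ^ n) ≤ digit (g t) n := fun t n => by
    rw [hgd]
    push_cast
    linarith [hA1 n, Nat.cast_nonneg (α := ℝ) (cantorDigit A t n)]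
  have hupp : ∀ t ∈ Ico (0 : ℝ) 1, ∀ n, (digit (g t) n : ℝ) ≤ 4 * Real.exp (l ^ n) := by
    intro t ht n
    have h1 : (cantorDigit A t n : ℝ) < A n := by
      exact_mod_cast cantorDigit_lt (fun n => by have := hA3 n; omega) ht n
    rw [hgd]
    push_cast
    linarith [hA2 n]
  obtain ⟨C, hC⟩ := exists_bound_geometric_mul_exp hl hr
  have hslope : ∀ t ∈ Ico (0 : ℝ) 1, ∀ n, slope (g t) n ≤
      16 ^ n * Real.exp (2 * ∑ i ∈ Finset.range n, l ^ i) := by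
    intro t ht n
    calc slope (g t) n ≤ ∏ i ∈ Finset.range n, (16 * Real.exp (2 * l ^ i)) := by
          refine Finset.prod_le_prod (fun i _ => ?_) fun i _ => ?_
          · have := two_le_digit (hg t) i
            apply mul_nonneg <;> linarith
          · have h1 := two_le_digit (hg t) i
            have h2 := hupp t ht i
            rw [two_mul (l ^ i), Real.exp_add]
            nlinarith
      _ = _ := by rw [Finset.prod_mul_distrib, ← Real.exp_sum, Finset.mul_sum]; simp
  have hprod : ∀ n, Real.exp (∑ i ∈ Finset.range n, l ^ i) ≤
      ∏ i ∈ Finset.range n, (A i : ℝ) := by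
    intro n
    rw [Real.exp_sum]
    exact Finset.prod_le_prod (fun i _ => (Real.exp_pos _).le) fun i _ => hA1 i
  -- the Hölder inequality for two points whose first difference is at `n`; the constant is
  -- `4 B = 128 * 16 ^ n` with `B = 2 * 16 ^ (n + 1)`, where one factor `16` bounds `slope` per digit
  -- and the last one bounds the product of the two differing digits
  have hkey : ∀ t ∈ Ico (0 : ℝ) 1, ∀ u ∈ Ico (0 : ℝ) 1, ∀ n,
      (∀ i < n, cantorDigit A t i = cantorDigit A u i) → cantorDigit A t n < cantorDigit A u n →
      |t - u| ≤ 128 * C * |g t - g u| ^ r := by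
    intro t ht u hu n heq hlt
    have hdist := abs_sub_le_of_cantorDigit_lt ht hu heq hlt
    have hsep := separation (hg t) (hg u) (n := n)
      (fun i hi => by rw [hgd, hgd, heq i hi]) (by rw [hgd, hgd]; omega)
      (by rw [hgd]; have := hA3 (n + 1); omega)
    have hj : (digit (g u) n : ℝ) - digit (g t) n = cantorDigit A u n - cantorDigit A t n := by
      rw [hgd, hgd]
      push_cast
      ring
    rw [hj] at hsep
    have hlt' : (cantorDigit A t n : ℝ) + 1 ≤ cantorDigit A u n := by exact_mod_cast hlt
    have hju : (cantorDigit A u n : ℝ) ≤ 2 * Real.exp (l ^ n) := by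
      refine le_trans ?_ (hA2 n)
      exact_mod_cast (cantorDigit_lt (fun n => by have := hA3 n; omega) hu n).le
    refine holder_of_separation (j := cantorDigit A u n - cantorDigit A t n)
      (B := 2 * 16 ^ (n + 1)) (S := ∑ i ∈ Finset.range (n + 1), l ^ i) (L := l ^ n)
      (by linarith) (by linarith [Nat.cast_nonneg (α := ℝ) (cantorDigit A t n)]) ?_ hr0 hr1 ?_ ?_ ?_
    · have : (1 : ℝ) ≤ 16 ^ (n + 1) := one_le_pow₀ (by norm_num)
      linarith
    · have := hC n
      rw [pow_succ]
      linarith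
    · exact (mul_le_mul_of_nonneg_right (hprod (n + 1)) (abs_nonneg _)).trans hdist
    · have h1 : (digit (g t) n : ℝ) * digit (g u) n ≤ 16 * Real.exp (2 * l ^ n) := by
        rw [two_mul, Real.exp_add]
        calc _ ≤ (4 * Real.exp (l ^ n)) * (4 * Real.exp (l ^ n)) := by
              gcongr
              · exact hupp t ht n
              · exact hupp u hu n
          _ = _ := by ring
      refine hsep.trans ?_
      calc 2 * ((digit (g t) n : ℝ) * digit (g u) n) * (slope (g t) n * (g t - g u))
          ≤ 2 * ((digit (g t) n : ℝ) * digit (g u) n) * (slope (g t) n * |g t - g u|) := by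
            have := slope_pos (hg t) n
            gcongr
            exact le_abs_self _
        _ ≤ 2 * (16 * Real.exp (2 * l ^ n)) *
              ((16 ^ n * Real.exp (2 * ∑ i ∈ Finset.range n, l ^ i)) * |g t - g u|) := by
            have := slope_pos (hg t) n
            gcongr
            exact hslope t ht n
        _ = _ := by
            rw [Finset.sum_range_succ, mul_add, Real.exp_add]
            ring
  have hholder : ∀ t ∈ Ico (0 : ℝ) 1, ∀ u ∈ Ico (0 : ℝ) 1,
      |t - u| ≤ 128 * C * |g t - g u| ^ r := by
    intro t ht u hu
    by_cases h : ∀ n, cantorDigit A t n = cantorDigit A u n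
    · rw [eq_of_cantorDigit_eq (fun n => by have := hA3 n; omega) ht hu h]
      simp [Real.zero_rpow hr0.ne']
    · push Not at h
      classical
      have hmin : ∀ i < Nat.find h, cantorDigit A t i = cantorDigit A u i := fun i hi => by
        simpa using Nat.find_min h hi
      rcases lt_or_gt_of_ne (Nat.find_spec h) with hlt | hlt
      · exact hkey t ht u hu _ hmin hlt
      · rw [abs_sub_comm t, abs_sub_comm (g t)]
        exact hkey u hu t ht _ (fun i hi => (hmin i hi).symm) hlt
  refine (ofReal_le_dimH_image hr0 hholder).trans (dimH_mono ?_)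
  rintro _ ⟨t, ht, rfl⟩
  exact mem_growthSet hl hlβ (hg t) (hlow t) (hupp t ht)

theorem le_dimH_growthSet {β : ℝ} (hβ : 0 < β) :
    ENNReal.ofReal (2 / (3 + β + Real.sqrt (β ^ 2 + 6 * β + 1))) ≤ dimH (growthSet β) := by
  set q := Real.sqrt (β ^ 2 + 6 * β + 1) with hq
  have hsq : q ^ 2 = β ^ 2 + 6 * β + 1 := Real.sq_sqrt (by positivity)
  have hq1 : 1 ≤ q := by
    rw [hq, Real.one_le_sqrt]
    nlinarith
  -- the positive root of `l ^ 2 = (1 + β) l + β`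
  set l := (1 + β + q) / 2 with hl
  have hl1 : 1 < l := by rw [hl]; linarith
  have hlβ : l ^ 2 = (1 + β) * l + β := by rw [hl]; linarith
  have heq : 2 / (3 + β + q) = 1 / (1 + l) := by
    rw [div_eq_div_iff (by linarith) (by linarith), hl]
    ring
  have hpos : 0 < 1 / (1 + l) := by apply one_div_pos.2; linarith
  rw [heq]
  refine le_of_tendsto ((ENNReal.continuous_ofReal.tendsto (1 / (1 + l))).mono_left
    (nhdsWithin_le_nhds (s := Iio (1 / (1 + l))))) ?_
  exact eventually_of_mem (Ioo_mem_nhdsLT hpos) fun r hr =>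
    ofReal_le_dimH_growthSet hl1 hlβ hr.1 hr.2

end Luroth

theorem mainTheorem1 (β : ℝ) (hβ : 0 < β) :
    ENNReal.ofReal (2 / (3 + β + Real.sqrt (β ^ 2 + 6 * β + 1))) ≤ dimH (Luroth.growthSet β) ∧
      dimH (Luroth.growthSet β) ≤ ENNReal.ofReal (1 / (2 + β)) :=
  ⟨Luroth.le_dimH_growthSet hβ, Luroth.dimH_growthSet_le hβ⟩
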